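/- Let $\mathcal H_s,\mathcal H_e$ be complex Hilbert spaces of arbitrary dimension (system and environment) and let $\mathcal H=\mathcal H_s\otimes\mathcal H_e$ be their Hilbert space tensor product. For $t\in\mathbb R$ let $H_0(t),H_1(t),\dots,H_r(t),C(t)$ be (possibly unbounded) linear operators in $\mathcal H_s$, $H_e(t)$ a linear operator in $\mathcal H_e$ and $H_{SB}(t)$ a linear operator in $\mathcal H$. A factor $-i/\hbar$ is absorbed into the Hamiltonians; $A\otimes 1$ and $1\otimes B$ denote the closures of the operators on the algebraic tensor products $\operatorname{dom}A\otimes\mathcal H_e$ and $\mathcal H_s\otimes\operatorname{dom}B$ (if not closable, these operators themselves). Consider the quantum control system $$\dot\xi=\Big(H_0(t)\otimes 1+1\otimes H_e(t)+\sum_{i=1}^r u_i(t)\,H_i(t)\otimes 1+H_{SB}(t)\Big)\xi,\qquad y(t,\xi)=\langle\xi\,|\,(C(t)\otimes 1)\,|\,\xi\rangle .$$ Let $\mathcal M$ be the state manifold: a real analytic manifold without boundary, modelled on a real Banach space (of finite or infinite dimension), injectively and analytically immersed (with injective differentials) in the unit sphere of $\mathcal H$, contained for every $t$ in the domains of the operators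 $H_0\otimes1+1\otimes H_e$, $H_i\otimes 1$, $H_{SB}$, $C\otimes 1$ at time $t$, and tangent to the vectors $(H_0\otimes 1+1\otimes H_e)\xi$, $(H_i\otimes 1)\xi$, $H_{SB}\xi$ at each $\xi\in\mathcal M$. On the augmented manifold $\mathbb R\times\mathcal M$, with points $(t,\xi)$, define the vector fields $$K_0=\begin{pmatrix}1\\(H_0(t)\otimes1+1\otimes H_e(t))\xi\end{pmatrix},\quad K_i=\begin{pmatrix}0\\(H_i(t)\otimes1)\xi\end{pmatrix}\ (1\le i\le r),\quad K_I=\begin{pmatrix}0\\H_{SB}(t)\xi\end{pmatrix},$$ so that the system becomes the augmented system $\frac{d}{dt}(t,\xi)=K_0+\sum_i u_iK_i+K_I$. Call it analytic if $K_0,\dots,K_r,K_I$ and $y$ are real analytic on $\mathbb R\times\mathcal M$. Let the class $\mathcal U$ of admissible controls consist of piecewise continuous functions $u:\mathbb R\to\mathbb R^r$ (finitely many discontinuities on each bounded interval, with finite one-sided limits everywhere) and contain all piecewise constant functions with values in $\Omega$, for some set $\Omega\subseteq\mathbb R^r$ whose affine hull is $\mathbb R^r$. A solution on $[a,b]$ for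 the control $u$ is a continuous curve $\xi:[a,b]\to\mathcal M$ such that $t\mapsto(t,\xi(t))$ satisfies the augmented system in $(a,b)$ except at finitely many times. The output $y$ is invariant under $H_{SB}$ if for every $u\in\mathcal U$, all $a\le b$, every solution $\xi$ on $[a,b]$ for $u$, and every solution $\eta$ on $[a,b]$ for $u$ of the system with $H_{SB}$ replaced by $0$, such that $\xi(a)=\eta(a)$, one has $y(t,\xi(t))=y(t,\eta(t))$ for all $t\in[a,b]$. **Lemma.** If the augmented system is analytic, then $y$ is invariant under the given $H_{SB}$ if and only if $$L_{K_I}L_{X_1}\cdots L_{X_p}\,y=0\quad\text{on all of }\mathbb R\times\mathcal M$$ for all integers $p\ge0$ and all $X_1,\dots,X_p\in\{K_0,K_1,\dots,K_r\}$, where $L_X f=df(X)$ denotes the Lie derivative of a function. -/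

import Mathlib

open scoped TensorProduct Manifold ContDiff Topology
open Set Filter

namespace OpenQuantum

/-- The Hilbert space of the composite of a system and its environment: the Hilbert space tensor
product, that is, the completion of the algebraic tensor product. -/
abbrev JointSpace (HS HE : Type*) [NormedAddCommGroup HS] [InnerProductSpace ℂ HS]
    [NormedAddCommGroup HE] [InnerProductSpace ℂ HE] : Type _ :=
  UniformSpace.Completion (HS ⊗[ℂ] HE)

section Ampliation

variable {HS HE : Type*} [NormedAddCommGroup HS] [InnerProductSpace ℂ HS]
  [NormedAddCommGroup HE] [InnerProductSpace ℂ HE]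

/-- The graph of `A ⊗ 1` with domain the algebraic tensor product `dom A ⊗ HE`. -/
noncomputable def ampLeftGraph (A : HS →ₗ.[ℂ] HS) :
    Submodule ℂ (JointSpace HS HE × JointSpace HS HE) :=
  LinearMap.range
    (((UniformSpace.Completion.toComplₗᵢ (𝕜 := ℂ) (E := HS ⊗[ℂ] HE)).toLinearMap ∘ₗ
        LinearMap.rTensor HE A.domain.subtype).prod
      ((UniformSpace.Completion.toComplₗᵢ (𝕜 := ℂ) (E := HS ⊗[ℂ] HE)).toLinearMap ∘ₗ
        LinearMap.rTensor HE A.toFun))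

/-- The graph of `1 ⊗ B` with domain the algebraic tensor product `HS ⊗ dom B`. -/
noncomputable def ampRightGraph (B : HE →ₗ.[ℂ] HE) :
    Submodule ℂ (JointSpace HS HE × JointSpace HS HE) :=
  LinearMap.range
    (((UniformSpace.Completion.toComplₗᵢ (𝕜 := ℂ) (E := HS ⊗[ℂ] HE)).toLinearMap ∘ₗ
        LinearMap.lTensor HS B.domain.subtype).prod
      ((UniformSpace.Completion.toComplₗᵢ (𝕜 := ℂ) (E := HS ⊗[ℂ] HE)).toLinearMap ∘ₗ
        LinearMap.lTensor HS B.toFun))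

/-- The operator `A ⊗ 1` on the joint space, for a possibly unbounded operator `A` of the
system: the closure of `A ⊗ 1` on `dom A ⊗ HE`. -/
noncomputable def ampLeft (A : HS →ₗ.[ℂ] HS) : JointSpace HS HE →ₗ.[ℂ] JointSpace HS HE :=
  (ampLeftGraph A).toLinearPMap.closure

/-- The operator `1 ⊗ B` on the joint space, for a possibly unbounded operator `B` of the
environment: the closure of `1 ⊗ B` on `HS ⊗ dom B`. -/
noncomputable def ampRight (B : HE →ₗ.[ℂ] HE) : JointSpace HS HE →ₗ.[ℂ] JointSpace HS HE :=
  (ampRightGraph B).toLinearPMap.closure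

/-- `ampLeftGraph` is the graph of an operator, so `toLinearPMap` takes no default value. -/
theorem ampLeftGraph_single_valued (A : HS →ₗ.[ℂ] HS)
    (x : JointSpace HS HE × JointSpace HS HE) (hx : x ∈ ampLeftGraph A) (h0 : x.1 = 0) :
    x.2 = 0 := by
  obtain ⟨d, rfl⟩ := hx
  have h1 : UniformSpace.Completion.toComplₗᵢ (𝕜 := ℂ) (E := HS ⊗[ℂ] HE)
      (LinearMap.rTensor HE A.domain.subtype d) = 0 := h0
  have h2 : LinearMap.rTensor HE A.domain.subtype d = 0 :=
    (UniformSpace.Completion.toComplₗᵢ (𝕜 := ℂ) (E := HS ⊗[ℂ] HE)).injective (by simpa using h1)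
  have h3 : d = 0 := Module.Flat.rTensor_preserves_injective_linearMap (M := HE)
    A.domain.subtype A.domain.injective_subtype (by simpa using h2)
  simp [h3]

/-- `ampRightGraph` is the graph of an operator, so `toLinearPMap` takes no default value. -/
theorem ampRightGraph_single_valued (B : HE →ₗ.[ℂ] HE)
    (x : JointSpace HS HE × JointSpace HS HE) (hx : x ∈ ampRightGraph B) (h0 : x.1 = 0) :
    x.2 = 0 := by
  obtain ⟨d, rfl⟩ := hx
  have h1 : UniformSpace.Completion.toComplₗᵢ (𝕜 := ℂ) (E := HS ⊗[ℂ] HE)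
      (LinearMap.lTensor HS B.domain.subtype d) = 0 := h0
  have h2 : LinearMap.lTensor HS B.domain.subtype d = 0 :=
    (UniformSpace.Completion.toComplₗᵢ (𝕜 := ℂ) (E := HS ⊗[ℂ] HE)).injective (by simpa using h1)
  have h3 : d = 0 := Module.Flat.lTensor_preserves_injective_linearMap (M := HS)
    B.domain.subtype B.domain.injective_subtype (by simpa using h2)
  simp [h3]

end Ampliation

/-- The time dependent, possibly unbounded operators of an open quantum control system with
`r` controls and of its output. The factor `-i / ℏ` is absorbed into the Hamiltonians, so that
the Schrödinger equation reads `∂ξ/∂t = (H₀ ⊗ 1 + 1 ⊗ Hₑ + H_SB + ∑ uᵢ Hᵢ ⊗ 1) ξ`. -/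
structure OpenSystem (HS HE : Type*) [NormedAddCommGroup HS] [InnerProductSpace ℂ HS]
    [NormedAddCommGroup HE] [InnerProductSpace ℂ HE] (r : ℕ) where
  /-- drift Hamiltonian of the system -/
  H0 : ℝ → HS →ₗ.[ℂ] HS
  /-- drift Hamiltonian of the environment -/
  He : ℝ → HE →ₗ.[ℂ] HE
  /-- control Hamiltonians of the system -/
  H : Fin r → ℝ → HS →ₗ.[ℂ] HS
  /-- interaction Hamiltonian -/
  HSB : ℝ → JointSpace HS HE →ₗ.[ℂ] JointSpace HS HE
  /-- output operator of the system, not necessarily Hermitian -/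
  C : ℝ → HS →ₗ.[ℂ] HS

section Systems

variable {HS HE : Type*} [NormedAddCommGroup HS] [InnerProductSpace ℂ HS]
  [NormedAddCommGroup HE] [InnerProductSpace ℂ HE] {r : ℕ}

/-- The same system with the interaction Hamiltonian replaced by `0`. -/
noncomputable def OpenSystem.decoupled (Q : OpenSystem HS HE r) : OpenSystem HS HE r where
  H0 := Q.H0
  He := Q.He
  H := Q.H
  HSB := fun _ => 0
  C := Q.C

/-- The drift operator `H₀ ⊗ 1 + 1 ⊗ Hₑ`, on the intersection of the two domains. -/
noncomputable def OpenSystem.drift (Q : OpenSystem HS HE r) (t : ℝ) :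
    JointSpace HS HE →ₗ.[ℂ] JointSpace HS HE :=
  ampLeft (Q.H0 t) + ampRight (Q.He t)

/-- A state manifold `M` of an open quantum system: an analytic manifold modelled on the real
normed space `E`, injectively and analytically immersed in the unit sphere of the joint space,
contained in the domains of all the operators of the system and tangent to the right hand sides
of the Schrödinger equation. The vectors `X0 t p`, `X i t p` and `XI t p` are these right hand
sides as (uniquely determined) tangent vectors of `M`. -/
structure StateManifold (Q : OpenSystem HS HE r) (E M : Type*)
    [NormedAddCommGroup E] [NormedSpace ℝ E] [TopologicalSpace M] [ChartedSpace E M] where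
  /-- the inclusion of the state manifold in the joint space -/
  ι : M → JointSpace HS HE
  injective_ι : Function.Injective ι
  contMDiff_ι : ContMDiff 𝓘(ℝ, E) 𝓘(ℝ, JointSpace HS HE) ω ι
  injective_mfderiv_ι : ∀ p : M,
    Function.Injective (mfderiv 𝓘(ℝ, E) 𝓘(ℝ, JointSpace HS HE) ι p)
  norm_ι : ∀ p : M, ‖ι p‖ = 1
  mem_drift : ∀ (t : ℝ) (p : M), ι p ∈ (Q.drift t).domain
  mem_H : ∀ (i : Fin r) (t : ℝ) (p : M), ι p ∈ (ampLeft (HE := HE) (Q.H i t)).domain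
  mem_HSB : ∀ (t : ℝ) (p : M), ι p ∈ (Q.HSB t).domain
  mem_C : ∀ (t : ℝ) (p : M), ι p ∈ (ampLeft (HE := HE) (Q.C t)).domain
  /-- drift vector field -/
  X0 : ℝ → (p : M) → TangentSpace 𝓘(ℝ, E) p
  /-- control vector fields -/
  X : Fin r → ℝ → (p : M) → TangentSpace 𝓘(ℝ, E) p
  /-- interaction vector field -/
  XI : ℝ → (p : M) → TangentSpace 𝓘(ℝ, E) p
  mfderiv_X0 : ∀ (t : ℝ) (p : M),
    mfderiv 𝓘(ℝ, E) 𝓘(ℝ, JointSpace HS HE) ι p (X0 t p) = Q.drift t ⟨ι p, mem_drift t p⟩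
  mfderiv_X : ∀ (i : Fin r) (t : ℝ) (p : M),
    mfderiv 𝓘(ℝ, E) 𝓘(ℝ, JointSpace HS HE) ι p (X i t p) =
      ampLeft (HE := HE) (Q.H i t) ⟨ι p, mem_H i t p⟩
  mfderiv_XI : ∀ (t : ℝ) (p : M),
    mfderiv 𝓘(ℝ, E) 𝓘(ℝ, JointSpace HS HE) ι p (XI t p) = Q.HSB t ⟨ι p, mem_HSB t p⟩

/-- The Lie derivative `L_X f` of a complex valued function `f` on the augmented manifold
`ℝ × M` along a vector field `X`. -/
noncomputable def lieDeriv {E M : Type*} [NormedAddCommGroup E] [NormedSpace ℝ E]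
    [TopologicalSpace M] [ChartedSpace E M]
    (X : (q : ℝ × M) → TangentSpace (𝓘(ℝ, ℝ).prod 𝓘(ℝ, E)) q) (f : ℝ × M → ℂ) : ℝ × M → ℂ :=
  fun q => mfderiv (𝓘(ℝ, ℝ).prod 𝓘(ℝ, E)) 𝓘(ℝ, ℂ) f q (X q)

namespace StateManifold

variable {Q : OpenSystem HS HE r} {E M : Type*}
  [NormedAddCommGroup E] [NormedSpace ℝ E] [TopologicalSpace M] [ChartedSpace E M]

/-- The vector fields `K₀ = (1, (H₀ + Hₑ) ξ)` and `Kᵢ = (0, Hᵢ ξ)`, `1 ≤ i ≤ r`, on the augmented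
manifold `ℝ × M`. -/
def K (S : StateManifold Q E M) (i : Fin (r + 1)) (q : ℝ × M) :
    TangentSpace (𝓘(ℝ, ℝ).prod 𝓘(ℝ, E)) q :=
  Fin.cases (motive := fun _ => ℝ × E) ((1 : ℝ), (S.X0 q.1 q.2 : E))
    (fun j => ((0 : ℝ), (S.X j q.1 q.2 : E))) i

/-- The interaction vector field `K_I = (0, H_SB ξ)` on the augmented manifold. -/
def KI (S : StateManifold Q E M) (q : ℝ × M) : TangentSpace (𝓘(ℝ, ℝ).prod 𝓘(ℝ, E)) q :=
  (((0 : ℝ), (S.XI q.1 q.2 : E)) : ℝ × E)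

/-- The output `y(t, ξ) = ⟨ξ | C(t) | ξ⟩`. -/
noncomputable def y (S : StateManifold Q E M) (q : ℝ × M) : ℂ :=
  inner ℂ (S.ι q.2) (ampLeft (HE := HE) (Q.C q.1) ⟨S.ι q.2, S.mem_C q.1 q.2⟩)

/-- The augmented system is analytic: its vector fields and its output are (real) analytic on
the augmented manifold. -/
def IsAnalytic [IsManifold 𝓘(ℝ, E) ω M] (S : StateManifold Q E M) : Prop :=
  (∀ i, ContMDiff (𝓘(ℝ, ℝ).prod 𝓘(ℝ, E)) (𝓘(ℝ, ℝ).prod 𝓘(ℝ, E)).tangent ω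
    (fun q : ℝ × M => (⟨q, S.K i q⟩ : TangentBundle (𝓘(ℝ, ℝ).prod 𝓘(ℝ, E)) (ℝ × M)))) ∧
  ContMDiff (𝓘(ℝ, ℝ).prod 𝓘(ℝ, E)) (𝓘(ℝ, ℝ).prod 𝓘(ℝ, E)).tangent ω
    (fun q : ℝ × M => (⟨q, S.KI q⟩ : TangentBundle (𝓘(ℝ, ℝ).prod 𝓘(ℝ, E)) (ℝ × M))) ∧
  ContMDiff (𝓘(ℝ, ℝ).prod 𝓘(ℝ, E)) 𝓘(ℝ, ℂ) ω S.y

/-- The right hand side `K₀ + ∑ uᵢ Kᵢ + K_I` of the augmented system. -/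
noncomputable def rhs (S : StateManifold Q E M) (u : Fin r → ℝ) (q : ℝ × M) :
    TangentSpace (𝓘(ℝ, ℝ).prod 𝓘(ℝ, E)) q :=
  S.K 0 q + ∑ i, u i • S.K i.succ q + S.KI q

/-- `ξ` is a solution on `[a, b]` of the system under the control `u`: it is continuous, and,
with at most finitely many exceptional times (the switching times of the control), the augmented
curve `t ↦ (t, ξ t)` has velocity `K₀ + ∑ uᵢ Kᵢ + K_I`. -/
def IsSolution (S : StateManifold Q E M) (u : ℝ → Fin r → ℝ) (a b : ℝ) (ξ : ℝ → M) : Prop :=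
  ContinuousOn ξ (Icc a b) ∧ ∃ F : Set ℝ, F.Finite ∧ ∀ t ∈ Ioo a b \ F,
    HasMFDerivAt 𝓘(ℝ, ℝ) (𝓘(ℝ, ℝ).prod 𝓘(ℝ, E)) (fun s => (s, ξ s)) t
      ((1 : ℝ →L[ℝ] ℝ).smulRight (S.rhs (u t) (t, ξ t)))

/-- The same state manifold for the system without interaction. -/
noncomputable def decoupled (S : StateManifold Q E M) : StateManifold Q.decoupled E M where
  ι := S.ι
  injective_ι := S.injective_ι
  contMDiff_ι := S.contMDiff_ι
  injective_mfderiv_ι := S.injective_mfderiv_ι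
  norm_ι := S.norm_ι
  mem_drift := S.mem_drift
  mem_H := S.mem_H
  mem_HSB := fun _ _ => Submodule.mem_top
  mem_C := S.mem_C
  X0 := S.X0
  X := S.X
  XI := fun _ _ => 0
  mfderiv_X0 := S.mfderiv_X0
  mfderiv_X := S.mfderiv_X
  mfderiv_XI := fun _ _ => map_zero _

/-- The output is invariant under the interaction Hamiltonian, for the class `𝒰` of admissible
controls: for every admissible control, and every initial time and state, the output of the
system agrees with the output of the system with `H_SB = 0` as long as both solutions exist. -/
def OutputInvariant (S : StateManifold Q E M) (𝒰 : Set (ℝ → Fin r → ℝ)) : Prop :=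
  ∀ u ∈ 𝒰, ∀ a b : ℝ, a ≤ b → ∀ ξ η : ℝ → M,
    S.IsSolution u a b ξ → S.decoupled.IsSolution u a b η → ξ a = η a →
      ∀ t ∈ Icc a b, S.y (t, ξ t) = S.decoupled.y (t, η t)

end StateManifold

end Systems

/-- `u` is piecewise constant: on each bounded interval it is locally constant except at finitely
many points. -/
def IsPiecewiseConstant {r : ℕ} (u : ℝ → Fin r → ℝ) : Prop :=
  ∀ a b : ℝ, ∃ F : Set ℝ, F.Finite ∧ ∀ t ∈ Ioo a b \ F, ∀ᶠ s in 𝓝 t, u s = u t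

/-- `u` is piecewise continuous: on each bounded interval it is continuous except at finitely
many points, and it has finite one-sided limits everywhere. -/
def IsPiecewiseContinuous {r : ℕ} (u : ℝ → Fin r → ℝ) : Prop :=
  (∀ a b : ℝ, ∃ F : Set ℝ, F.Finite ∧ ∀ t ∈ Ioo a b \ F, ContinuousAt u t) ∧
  ∀ t, (∃ l, Tendsto u (𝓝[<] t) (𝓝 l)) ∧ ∃ l, Tendsto u (𝓝[>] t) (𝓝 l)

/-- A class of admissible controls: piecewise continuous controls, including all the piecewise
constant ones with values in some set `Ω` of control values that does not lie in a proper affine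
subspace of `ℝ^r`. -/
def IsAdmissibleClass {r : ℕ} (𝒰 : Set (ℝ → Fin r → ℝ)) : Prop :=
  (∀ u ∈ 𝒰, IsPiecewiseContinuous u) ∧
  ∃ Ω : Set (Fin r → ℝ), affineSpan ℝ Ω = ⊤ ∧
    ∀ u : ℝ → Fin r → ℝ, IsPiecewiseConstant u → (∀ t, u t ∈ Ω) → u ∈ 𝒰

end OpenQuantum

/-! Write `Y w` for the iterated Lie derivative of the output along a word `w` in `K₀, …, K_r`.

Sufficiency. If `K_I` annihilates every `Y w`, then along a solution of either system the derivative
of `Y w` is `∑ cᵢ Y (i :: w)` with `c = (1, u)`. The differences `z w` of these values along the two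
solutions therefore satisfy an infinite linear system with zero initial data. Such systems lack
uniqueness in general, but analyticity supplies the locally uniform bound `‖Y w‖ ≤ C R^n n!`, `n`
the length of `w` (`exists_norm_foldr_lieOp_le`), and in this growth class the only solution is zero
on a short interval (`eq_zero_of_factorial_growth`). A connectedness argument on `[a, b]` finishes
(`y_eq_of_lieKI_foldr_eq_zero`).

Necessity. Outputs agree at pairs of states reached by both systems under one piecewise constant
control. Prolonging the control by a constant `v` and differentiating from the right, repeatedly,
gives equality of the words in `L₀ + ∑ vᵢ Lᵢ + L_I` and in `L₀ + ∑ vᵢ Lᵢ` applied to `y`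
(`foldr_eq_of_jointlyReachable`). On the diagonal this forces `L_I` to kill all words in the affine
operators. As `Ω` affinely spans `ℝ^r`, the single letters `Kᵢ` can be extracted
(`map_foldr_eq_zero_of_affineSpan_eq_top`). -/

namespace OpenQuantum

/-! ### Cauchy estimates for real analytic maps between normed spaces. -/

section CauchyEstimates

open scoped NNReal ENNReal Nat

variable {F G : Type*} [NormedAddCommGroup F] [NormedSpace ℝ F]
  [NormedAddCommGroup G] [NormedSpace ℝ G]

theorem norm_iteratedFDeriv_le_factorial_mul [CompleteSpace G] {f : F → G}
    {p : FormalMultilinearSeries ℝ F G} {x : F} {r : ℝ≥0∞}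
    (h : HasFPowerSeriesOnBall f p x r) (k : ℕ) :
    ‖iteratedFDeriv ℝ k f x‖ ≤ k ! * ‖p k‖ := by
  refine ContinuousMultilinearMap.opNorm_le_bound (by positivity) fun v => ?_
  rw [h.iteratedFDeriv_eq_sum_of_completeSpace v]
  refine (norm_sum_le _ _).trans ?_
  have : ∀ σ ∈ (Finset.univ : Finset (Equiv.Perm (Fin k))),
      ‖p k (fun i => v (σ i))‖ ≤ ‖p k‖ * ∏ i, ‖v i‖ := fun σ _ => by
    refine ((p k).le_opNorm _).trans_eq ?_
    rw [Equiv.prod_comp σ (fun i => ‖v i‖)]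
  refine (Finset.sum_le_card_nsmul _ _ _ this).trans_eq ?_
  rw [Finset.card_univ, Fintype.card_perm, Fintype.card_fin, nsmul_eq_mul, mul_assoc]

/-- The majorant of the recentred coefficients is monotone in `‖y‖`, so the convergent double series
at radius `r` bounds all centres at once. -/
theorem exists_nnnorm_changeOrigin_mul_pow_le (p : FormalMultilinearSeries ℝ F G) {r r' : ℝ≥0}
    (hr : (r + r' : ℝ≥0∞) < p.radius) :
    ∃ C : ℝ≥0, ∀ y : F, ‖y‖₊ ≤ r → ∀ k, ‖p.changeOrigin y k‖₊ * r' ^ k ≤ C := by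
  have hs := NNReal.summable_sigma.1 (p.changeOriginSeries_summable_aux₁ hr)
  have hr0 : (r : ℝ≥0∞) < p.radius := (le_add_right le_rfl).trans_lt hr
  refine ⟨_, fun y hy k => le_trans ?_ (hs.2.le_tsum k fun _ _ => zero_le)⟩
  have hy' : (‖y‖₊ : ℝ≥0∞) < p.radius := lt_of_le_of_lt (by exact_mod_cast hy) hr0
  simp only [NNReal.tsum_mul_right]
  gcongr
  refine (p.nnnorm_changeOrigin_le k hy').trans ?_
  refine (p.changeOriginSeries_summable_aux₂ hy' k).tsum_le_tsum (fun s => ?_)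
    (p.changeOriginSeries_summable_aux₂ hr0 k)
  gcongr

/-- Cauchy estimates for the derivatives of a real analytic function, uniformly in a
neighbourhood of a point. -/
theorem _root_.AnalyticAt.exists_norm_iteratedFDeriv_le [CompleteSpace G] {f : F → G} {x₀ : F}
    (hf : AnalyticAt ℝ f x₀) :
    ∃ C R : ℝ, 0 ≤ C ∧ 0 ≤ R ∧
      ∀ᶠ x in 𝓝 x₀, ∀ k, ‖iteratedFDeriv ℝ k f x‖ ≤ C * R ^ k * k ! := by
  obtain ⟨p, r, hp⟩ := hf
  obtain ⟨s, hs0, hsr⟩ := ENNReal.lt_iff_exists_nnreal_btwn.1 hp.r_pos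
  have hs0' : 0 < s := by exact_mod_cast hs0
  have hs2 : 0 < s / 2 := by positivity
  -- Half of the radius pays for moving the centre, the other half for the geometric rate `R = (s /
  -- 2)⁻¹`.
  have hsum : ((s / 2 : ℝ≥0) + (s / 2 : ℝ≥0) : ℝ≥0∞) < p.radius := by
    rw [← ENNReal.coe_add, add_halves]
    exact hsr.trans_le hp.r_le
  obtain ⟨C, hC⟩ := exists_nnnorm_changeOrigin_mul_pow_le p hsum
  refine ⟨C, (s / 2 : ℝ≥0)⁻¹, C.2, by positivity, ?_⟩
  filter_upwards [Metric.closedBall_mem_nhds x₀ (ε := (s / 2 : ℝ≥0)) (by exact_mod_cast hs2)]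
    with x hx k
  have hx' : ‖x - x₀‖₊ ≤ s / 2 := by
    rw [← NNReal.coe_le_coe, coe_nnnorm, ← dist_eq_norm]; exact hx
  have hxr : (‖x - x₀‖₊ : ℝ≥0∞) < r :=
    lt_of_le_of_lt (by exact_mod_cast hx'.trans (NNReal.half_le_self s)) hsr
  have hpx := hp.changeOrigin hxr
  rw [add_sub_cancel] at hpx
  refine (norm_iteratedFDeriv_le_factorial_mul hpx k).trans ?_
  rw [mul_comm]
  gcongr
  have h1 : ‖p.changeOrigin (x - x₀) k‖ * ((s / 2 : ℝ≥0) : ℝ) ^ k ≤ C := by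
    exact_mod_cast hC _ hx' k
  have h2 : (0 : ℝ) < ((s / 2 : ℝ≥0) : ℝ) ^ k := by positivity
  rw [inv_pow, ← div_eq_mul_inv, le_div_iff₀ h2]
  exact h1

end CauchyEstimates

/-! ### Factorial growth of iterated Lie derivatives in a normed space. -/

section LocalLieDerivatives

open scoped Nat

variable {F G ι : Type*} [NormedAddCommGroup F] [NormedSpace ℝ F]
  [NormedAddCommGroup G] [NormedSpace ℝ G]

/-- The iterated Lie derivative of a function on a normed space along a word of vector fields. -/
noncomputable def wordDeriv (X : ι → F → F) (f : F → G) (w : List ι) : F → G :=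
  w.foldr (fun i g x => fderiv ℝ g x (X i x)) f

theorem wordDeriv_cons (X : ι → F → F) (f : F → G) (i : ι) (w : List ι) :
    wordDeriv X f (i :: w) = fun x => fderiv ℝ (wordDeriv X f w) x (X i x) := rfl

theorem contDiffOn_wordDeriv {X : ι → F → F} {f : F → G} {U : Set F} (hU : IsOpen U)
    (hX : ∀ i, ContDiffOn ℝ ω (X i) U) (hf : ContDiffOn ℝ ω f U) (w : List ι) :
    ContDiffOn ℝ ω (wordDeriv X f w) U := by
  induction w with
  | nil => exact hf
  | cons i w ih => exact (ih.fderiv_of_isOpen hU (by simp)).clm_apply (hX i)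

/-- Leibniz rule for the pairing of `df` with `X`. After division by `R ^ k * k!` the binomial
coefficients cancel; the weight `i + 1` comes from `(i + 1)! = (i + 1) * i!`. -/
theorem norm_iteratedFDeriv_fderiv_apply_le {f : F → G} {X : F → F} {U : Set F} (hU : IsOpen U)
    (hf : ContDiffOn ℝ ω f U) (hX : ContDiffOn ℝ ω X U) {x : F} (hx : x ∈ U) {A R : ℝ}
    {b : ℕ → ℝ}
    (hXb : ∀ j, ‖iteratedFDeriv ℝ j X x‖ ≤ A * R ^ j * j !)
    (hfb : ∀ k, ‖iteratedFDeriv ℝ k f x‖ ≤ b k * R ^ k * k !) (k : ℕ) :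
    ‖iteratedFDeriv ℝ k (fun x => fderiv ℝ f x (X x)) x‖ ≤
      (A * R * ∑ i ∈ Finset.range (k + 1), (i + 1) * b (i + 1)) * R ^ k * k ! := by
  have key := ContinuousLinearMap.norm_iteratedFDerivWithin_le_of_bilinear_of_le_one
    (ContinuousLinearMap.id ℝ (F →L[ℝ] G)) (hf.fderiv_of_isOpen hU (m := ω) (by simp)) hX
    hU.uniqueDiffOn hx (n := k)
    (by simp) ContinuousLinearMap.norm_id_le
  rw [iteratedFDerivWithin_of_isOpen k hU hx] at key
  refine key.trans ?_
  rw [mul_assoc, Finset.mul_sum, Finset.sum_mul]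
  refine Finset.sum_le_sum fun i hi => ?_
  have hik : i ≤ k := Nat.lt_succ_iff.1 (Finset.mem_range.1 hi)
  rw [iteratedFDerivWithin_of_isOpen i hU hx, iteratedFDerivWithin_of_isOpen _ hU hx,
    norm_iteratedFDeriv_fderiv]
  have h1 := hfb (i + 1)
  have h2 := hXb (k - i)
  have h3 : (0 : ℝ) ≤ b (i + 1) * R ^ (i + 1) * (i + 1) ! := (norm_nonneg _).trans h1
  calc (k.choose i : ℝ) * ‖iteratedFDeriv ℝ (i + 1) f x‖ * ‖iteratedFDeriv ℝ (k - i) X x‖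
      ≤ k.choose i * (b (i + 1) * R ^ (i + 1) * (i + 1) !) *
          (A * R ^ (k - i) * (k - i)!) := by gcongr
    _ = A * R * ((i + 1) * b (i + 1)) * ((R ^ i * R ^ (k - i)) *
          (k.choose i * i ! * (k - i)!)) := by
        push_cast [Nat.factorial_succ]; ring
    _ = _ := by
        rw [← pow_add, Nat.add_sub_cancel' hik]
        norm_cast
        rw [Nat.choose_mul_factorial_mul_factorial hik]

/-- Hockey-stick identity after absorbing `i + 1` into the binomial. It makes the coefficients `(2n
+ k).choose (2n)` reproduce themselves, with `n + 1` for `n`, under the recursion of the preceding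
lemma. -/
theorem sum_succ_mul_choose (n k : ℕ) :
    ∑ i ∈ Finset.range (k + 1), (i + 1) * (2 * n + (i + 1)).choose (2 * n) =
      (2 * n + 1) * (2 * (n + 1) + k).choose (2 * (n + 1)) := by
  have h : ∀ i, (i + 1) * (2 * n + (i + 1)).choose (2 * n) =
      (2 * n + 1) * (i + (2 * n + 1)).choose (2 * n + 1) := fun i => by
    have := Nat.choose_succ_right_eq (2 * n + (i + 1)) (2 * n)
    rw [Nat.add_sub_cancel_left] at this
    rw [mul_comm, ← this, mul_comm, show i + (2 * n + 1) = 2 * n + (i + 1) by ring]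
  simp_rw [h]
  rw [← Finset.mul_sum, Nat.sum_range_add_choose]
  congr 2
  ring

/-- All orders `k` must be carried through the induction, since each letter consumes one derivative.
At `k = 0` the binomial is `1` and plain factorial growth remains. -/
theorem norm_iteratedFDeriv_wordDeriv_le {X : ι → F → F} {f : F → G} {U : Set F} (hU : IsOpen U)
    (hX : ∀ i, ContDiffOn ℝ ω (X i) U) (hf : ContDiffOn ℝ ω f U) {x : F} (hx : x ∈ U)
    {A B R : ℝ} (hA : 0 ≤ A) (hB : 0 ≤ B) (hR : 0 ≤ R)
    (hXb : ∀ i j, ‖iteratedFDeriv ℝ j (X i) x‖ ≤ A * R ^ j * j !)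
    (hfb : ∀ k, ‖iteratedFDeriv ℝ k f x‖ ≤ B * R ^ k * k !) (w : List ι) (k : ℕ) :
    ‖iteratedFDeriv ℝ k (wordDeriv X f w) x‖ ≤
      (B * (2 * A * R) ^ w.length * w.length ! *
        ((2 * w.length + k).choose (2 * w.length) : ℕ)) * R ^ k * k ! := by
  induction w generalizing k with
  | nil => simpa [wordDeriv] using hfb k
  | cons i w ih =>
    refine (norm_iteratedFDeriv_fderiv_apply_le hU (contDiffOn_wordDeriv hU hX hf w) (hX i) hx
      (hXb i) ih k).trans ?_
    gcongr ?_ * _ * _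
    have hsum : ∑ j ∈ Finset.range (k + 1), ((j : ℝ) + 1) * (B * (2 * A * R) ^ w.length *
        w.length ! * ((2 * w.length + (j + 1)).choose (2 * w.length) : ℕ)) =
        B * (2 * A * R) ^ w.length * w.length ! *
          ((2 * w.length + 1) * ((2 * (w.length + 1) + k).choose (2 * (w.length + 1)) : ℕ)) := by
      have := congrArg (fun m : ℕ => (m : ℝ)) (sum_succ_mul_choose w.length k)
      push_cast at this
      rw [← this, Finset.mul_sum]
      exact Finset.sum_congr rfl fun j _ => by ring
    rw [hsum, List.length_cons]
    -- Rounding `2n + 1` up to `2 (n + 1)` supplies the factor `2` of `2 * A * R` and the next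
    -- factor of the factorial.
    have : A * R * (B * (2 * A * R) ^ w.length * w.length ! *
          ((2 * w.length + 1) * ((2 * (w.length + 1) + k).choose (2 * (w.length + 1)) : ℕ))) ≤
        A * R * (B * (2 * A * R) ^ w.length * w.length ! *
          ((2 * w.length + 2) * ((2 * (w.length + 1) + k).choose (2 * (w.length + 1)) : ℕ))) := by
      gcongr
      norm_num
    refine this.trans_eq ?_
    push_cast [Nat.factorial_succ]
    ring

/-- Iterated Lie derivatives of an analytic function along finitely many analytic vector fields
grow at most factorially, uniformly in a neighbourhood of a point. -/
theorem exists_norm_wordDeriv_le [CompleteSpace F] [CompleteSpace G] [Finite ι]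
    {X : ι → F → F} {f : F → G} {x₀ : F}
    (hX : ∀ i, AnalyticAt ℝ (X i) x₀) (hf : AnalyticAt ℝ f x₀) :
    ∃ C R : ℝ, 0 ≤ C ∧ 0 ≤ R ∧ ∀ᶠ x in 𝓝 x₀, ∀ w : List ι,
      ‖wordDeriv X f w x‖ ≤ C * R ^ w.length * w.length ! := by
  cases nonempty_fintype ι
  choose A S hA hS hAS using fun i => (hX i).exists_norm_iteratedFDeriv_le
  obtain ⟨B, T, hB, hT, hBT⟩ := hf.exists_norm_iteratedFDeriv_le
  set A' := ∑ i, A i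
  set R' := T + ∑ i, S i
  have hA' : ∀ i, A i ≤ A' := fun i => Finset.single_le_sum (fun j _ => hA j) (Finset.mem_univ i)
  have hS' : ∀ i, S i ≤ R' := fun i =>
    (Finset.single_le_sum (fun j _ => hS j) (Finset.mem_univ i)).trans (le_add_of_nonneg_left hT)
  have hT' : T ≤ R' := le_add_of_nonneg_right (Finset.sum_nonneg fun j _ => hS j)
  have hA0 : 0 ≤ A' := Finset.sum_nonneg fun j _ => hA j
  have hR0 : 0 ≤ R' := hT.trans hT'
  refine ⟨B, 2 * A' * R', hB, by positivity, ?_⟩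
  have han : ∀ᶠ x in 𝓝 x₀, (∀ i, AnalyticAt ℝ (X i) x) ∧ AnalyticAt ℝ f x :=
    (eventually_all.2 fun i => (hX i).eventually_analyticAt).and hf.eventually_analyticAt
  obtain ⟨U, hUan, hU, hxU⟩ := eventually_nhds_iff.1 han
  filter_upwards [hU.mem_nhds hxU, hBT, eventually_all.2 hAS] with x hx hB' hA'' w
  have := norm_iteratedFDeriv_wordDeriv_le hU
    (fun i y hy => (((hUan y hy).1 i).contDiffAt).contDiffWithinAt)
    (fun y hy => ((hUan y hy).2.contDiffAt).contDiffWithinAt) hx hA0 hB hR0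
    (fun i j => (hA'' i j).trans (by
      have h1 := hA' i
      have h2 := hS' i
      have h3 := hA i
      have h4 := hS i
      gcongr))
    (fun k => (hB' k).trans (by gcongr)) w 0
  simpa using this

end LocalLieDerivatives

/-! ### Lie derivatives on a manifold and their expression in charts. -/

section LieOperators

open scoped Nat

variable {F H N : Type*} [NormedAddCommGroup F] [NormedSpace ℝ F] [TopologicalSpace H]
  {I : ModelWithCorners ℝ F H} [TopologicalSpace N] [ChartedSpace H N] [IsManifold I ω N]

/-- The Lie derivative along an analytic vector field, as an operator on analytic functions. -/
noncomputable def lieOp (X : (q : N) → TangentSpace I q)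
    (hX : ContMDiff I I.tangent ω (fun q => (⟨q, X q⟩ : TangentBundle I N))) :
    C^ω⟮I, N; 𝓘(ℝ, ℂ), ℂ⟯ →ₗ[ℝ] C^ω⟮I, N; 𝓘(ℝ, ℂ), ℂ⟯ where
  toFun f := ⟨fun q => mfderiv I 𝓘(ℝ, ℂ) f q (X q),
    (contMDiff_snd_tangentBundle_modelSpace ℂ 𝓘(ℝ, ℂ)).comp
      ((f.contMDiff.contMDiff_tangentMap (m := ω) (by simp)).comp hX)⟩
  map_add' f g := by
    ext q
    have hf : MDifferentiableAt I 𝓘(ℝ, ℂ) f q := f.contMDiff.mdifferentiable (by simp) q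
    have hg : MDifferentiableAt I 𝓘(ℝ, ℂ) g q := g.contMDiff.mdifferentiable (by simp) q
    exact DFunLike.congr_fun (hf.hasMFDerivAt.add hg.hasMFDerivAt).mfderiv (X q)
  map_smul' c f := by
    ext q
    have hf : MDifferentiableAt I 𝓘(ℝ, ℂ) f q := f.contMDiff.mdifferentiable (by simp) q
    exact DFunLike.congr_fun (hf.hasMFDerivAt.const_smul c).mfderiv (X q)

theorem lieOp_apply (X : (q : N) → TangentSpace I q)
    (hX : ContMDiff I I.tangent ω (fun q => (⟨q, X q⟩ : TangentBundle I N)))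
    (f : C^ω⟮I, N; 𝓘(ℝ, ℂ), ℂ⟯) (q : N) :
    lieOp X hX f q = mfderiv I 𝓘(ℝ, ℂ) f q (X q) := rfl

omit [IsManifold I ω N] in
/-- The derivative of an analytic function along a differentiable curve. -/
theorem hasDerivAt_comp_curve (f : C^ω⟮I, N; 𝓘(ℝ, ℂ), ℂ⟯) {γ : ℝ → N} {t : ℝ}
    {v : TangentSpace I (γ t)} {d : ℂ}
    (hγ : HasMFDerivAt 𝓘(ℝ, ℝ) I γ t ((1 : ℝ →L[ℝ] ℝ).smulRight v))
    (hd : mfderiv I 𝓘(ℝ, ℂ) f (γ t) v = d) :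
    HasDerivAt (fun s => f (γ s)) d t := by
  have hf : MDifferentiableAt I 𝓘(ℝ, ℂ) f (γ t) := f.contMDiff.mdifferentiable (by simp) _
  have h : HasFDerivAt (fun s => f (γ s))
      ((mfderiv I 𝓘(ℝ, ℂ) f (γ t) : TangentSpace I (γ t) →L[ℝ] ℂ).comp
        ((1 : ℝ →L[ℝ] ℝ).smulRight v)) t :=
    (HasMFDerivAt.comp t hf.hasMFDerivAt hγ).hasFDerivAt
  rw [hasDerivAt_iff_hasFDerivAt]
  have hc : ContinuousLinearMap.toSpanSingleton ℝ d =
      (mfderiv I 𝓘(ℝ, ℂ) f (γ t) : TangentSpace I (γ t) →L[ℝ] ℂ).comp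
        ((1 : ℝ →L[ℝ] ℝ).smulRight v) := by
    refine ContinuousLinearMap.ext_ring ?_
    rw [ContinuousLinearMap.toSpanSingleton_apply_one, ← hd]
    exact (congrArg (mfderiv I 𝓘(ℝ, ℂ) f (γ t)) (one_smul ℝ v)).symm
  rw [hc]
  exact h

/-- A vector field, read in the chart at a point. -/
noncomputable def chartField (X : (q : N) → TangentSpace I q) (q₀ : N) (e : F) : F :=
  (trivializationAt F (TangentSpace I) q₀
    ⟨(extChartAt I q₀).symm e, X ((extChartAt I q₀).symm e)⟩).2

variable [I.Boundaryless]

omit [IsManifold I ω N] in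
theorem analyticAt_comp_extChartAt_symm [CompleteSpace F] {G : Type*} [NormedAddCommGroup G]
    [NormedSpace ℝ G] [CompleteSpace G] {g : N → G} {q₀ : N} (hg : ContMDiffAt I 𝓘(ℝ, G) ω g q₀) :
    AnalyticAt ℝ (g ∘ (extChartAt I q₀).symm) (extChartAt I q₀ q₀) := by
  have h := contMDiffAt_iff.1 hg
  have h2 := h.2.contDiffAt (range_mem_nhds_isInteriorPoint BoundarylessManifold.isInteriorPoint)
  rw [extChartAt_model_space_eq_id] at h2
  exact h2.analyticAt

theorem analyticAt_chartField [CompleteSpace F] {X : (q : N) → TangentSpace I q}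
    (hX : ContMDiff I I.tangent ω (fun q => (⟨q, X q⟩ : TangentBundle I N))) (q₀ : N) :
    AnalyticAt ℝ (chartField X q₀) (extChartAt I q₀ q₀) :=
  analyticAt_comp_extChartAt_symm ((Bundle.contMDiffAt_section q₀).1 (hX q₀))

/-- The tangent bundle trivialization at `q₀` is the differential of the chart there, so this is the
chain rule for `f = (f ∘ κ.symm) ∘ κ` near the point. -/
theorem lieOp_extChartAt_symm {X : (q : N) → TangentSpace I q}
    (hX : ContMDiff I I.tangent ω (fun q => (⟨q, X q⟩ : TangentBundle I N)))
    (f : C^ω⟮I, N; 𝓘(ℝ, ℂ), ℂ⟯) {q₀ : N} {e : F} (he : e ∈ (extChartAt I q₀).target) :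
    lieOp X hX f ((extChartAt I q₀).symm e) =
      fderiv ℝ (fun e => f ((extChartAt I q₀).symm e)) e (chartField X q₀ e) := by
  set κ := extChartAt I q₀
  set q := κ.symm e with hq
  have hqs : q ∈ κ.source := κ.map_target he
  have hqs' : q ∈ (chartAt H q₀).source := by rwa [extChartAt_source] at hqs
  have hκq : κ q = e := κ.right_inv he
  have htar : κ.target ∈ 𝓝 e := (isOpen_extChartAt_target q₀).mem_nhds he
  have hκ : MDifferentiableAt I 𝓘(ℝ, F) κ q := mdifferentiableAt_extChartAt hqs'
  have hsymm : MDifferentiableAt 𝓘(ℝ, F) I κ.symm e :=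
    ((contMDiffOn_extChartAt_symm (n := ω) q₀).contMDiffAt htar).mdifferentiableAt (by simp)
  have hf : MDifferentiableAt I 𝓘(ℝ, ℂ) f q := f.contMDiff.mdifferentiable (by simp) q
  have hfs : MDifferentiableAt 𝓘(ℝ, F) 𝓘(ℝ, ℂ) (f ∘ κ.symm) e := hf.comp e hsymm
  have heq : (f ∘ κ.symm) ∘ κ =ᶠ[𝓝 q] f := by
    filter_upwards [(isOpen_extChartAt_source (I := I) q₀).mem_nhds hqs] with z hz
    simp only [Function.comp_apply]
    rw [κ.left_inv hz]
  have hcomp := mfderiv_comp_of_eq (hκq ▸ hfs) hκ rfl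
  rw [lieOp_apply, ← heq.mfderiv_eq, hcomp]
  have hfield : chartField X q₀ e = mfderiv I 𝓘(ℝ, F) κ q (X q) := by
    rw [← TangentBundle.continuousLinearMapAt_trivializationAt hqs']
    exact (Bundle.Trivialization.continuousLinearMapAt_apply_of_mem ℝ _
      (by rw [TangentBundle.trivializationAt_baseSet]; exact hqs') _).symm
  rw [hfield]
  have h1 : mfderiv 𝓘(ℝ, F) 𝓘(ℝ, ℂ) (f ∘ κ.symm) (κ q) = fderiv ℝ (fun e => f (κ.symm e)) e := by
    rw [hκq, mfderiv_eq_fderiv]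
    rfl
  exact DFunLike.congr_fun h1 (mfderiv I 𝓘(ℝ, F) κ q (X q))

theorem foldr_lieOp_extChartAt_symm {ι : Type*} {X : ι → (q : N) → TangentSpace I q}
    (hX : ∀ i, ContMDiff I I.tangent ω (fun q => (⟨q, X i q⟩ : TangentBundle I N)))
    (f : C^ω⟮I, N; 𝓘(ℝ, ℂ), ℂ⟯) (q₀ : N) (w : List ι) :
    EqOn (fun e => w.foldr (fun i => lieOp (X i) (hX i)) f ((extChartAt I q₀).symm e))
      (wordDeriv (fun i => chartField (X i) q₀) (f ∘ (extChartAt I q₀).symm) w)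
      (extChartAt I q₀).target := by
  induction w with
  | nil => exact fun _ _ => rfl
  | cons i w ih =>
    intro e he
    simp only [List.foldr_cons]
    rw [lieOp_extChartAt_symm _ _ he, wordDeriv_cons,
      (ih.eventuallyEq_of_mem ((isOpen_extChartAt_target q₀).mem_nhds he)).fderiv_eq]

/-- Iterated Lie derivatives of an analytic function grow at most factorially, locally
uniformly. -/
theorem exists_norm_foldr_lieOp_le [CompleteSpace F] {ι : Type*} [Finite ι]
    {X : ι → (q : N) → TangentSpace I q}
    (hX : ∀ i, ContMDiff I I.tangent ω (fun q => (⟨q, X i q⟩ : TangentBundle I N)))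
    (f : C^ω⟮I, N; 𝓘(ℝ, ℂ), ℂ⟯) (q₀ : N) :
    ∃ C R : ℝ, 0 ≤ C ∧ 0 ≤ R ∧ ∀ᶠ q in 𝓝 q₀, ∀ w : List ι,
      ‖w.foldr (fun i => lieOp (X i) (hX i)) f q‖ ≤ C * R ^ w.length * w.length ! := by
  obtain ⟨C, R, hC, hR, h⟩ := exists_norm_wordDeriv_le
    (fun i => analyticAt_chartField (hX i) q₀)
    (analyticAt_comp_extChartAt_symm (f.contMDiff q₀))
  refine ⟨C, R, hC, hR, ?_⟩
  filter_upwards [(continuousAt_extChartAt q₀).eventually h, extChartAt_source_mem_nhds (I := I) q₀]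
    with q hq hqs w
  have := foldr_lieOp_extChartAt_symm hX f q₀ w ((extChartAt I q₀).map_source hqs)
  simp only [(extChartAt I q₀).left_inv hqs] at this
  rw [this]
  exact hq w

end LieOperators

/-! ### Uniqueness for infinite linear systems indexed by words. -/

section InfiniteLinearSystems

open scoped Nat

/-- No derivative is available at `a`, so the mean value inequality is applied on `[c, t]` and `c`
tends to `a` from the right. -/
theorem norm_le_sub_of_norm_deriv_le_Ioo {V : Type*} [NormedAddCommGroup V] [NormedSpace ℝ V]
    {f f' : ℝ → V} {B B' : ℝ → ℝ} {a b : ℝ} (hf : ContinuousOn f (Icc a b))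
    (hf' : ∀ t ∈ Ioo a b, HasDerivAt f (f' t) t) (hB : ∀ t, HasDerivAt B (B' t) t)
    (bound : ∀ t ∈ Ioo a b, ‖f' t‖ ≤ B' t) (h0 : f a = 0) {t : ℝ} (ht : t ∈ Icc a b) :
    ‖f t‖ ≤ B t - B a := by
  rcases ht.1.eq_or_lt with rfl | hat
  · simp [h0]
  have hlim : Tendsto (fun c => ‖f c‖ + (B t - B c)) (𝓝[>] a) (𝓝 (‖f a‖ + (B t - B a))) := by
    refine Tendsto.add (Tendsto.norm ?_) (tendsto_const_nhds.sub ?_)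
    · exact (hf a ⟨le_rfl, hat.le.trans ht.2⟩).mono_of_mem_nhdsWithin
        (Icc_mem_nhdsGT (hat.trans_le ht.2))
    · exact (hB a).continuousAt.continuousWithinAt
  rw [h0, norm_zero, zero_add] at hlim
  refine ge_of_tendsto hlim ?_
  filter_upwards [Ioo_mem_nhdsGT hat] with c hc
  refine image_norm_le_of_norm_deriv_right_le_deriv_boundary (a := c) (b := t) (f := f) (f' := f')
    (B := fun x => ‖f c‖ + (B x - B c)) (B' := B')
    (hf.mono (Icc_subset_Icc hc.1.le ht.2)) (fun x hx => ?_) (by simp)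
    (fun x => ((hB x).sub_const _).const_add _) (fun x hx => ?_) ⟨hc.2.le, le_rfl⟩
  · exact (hf' x ⟨hc.1.trans_le hx.1, hx.2.trans_le ht.2⟩).hasDerivWithinAt
  · exact bound x ⟨hc.1.trans_le hx.1, hx.2.trans_le ht.2⟩

/-- Uniqueness for an infinite linear system indexed by words, in which the derivative of each
coordinate involves the coordinates of words longer by one letter, among solutions that grow at
most factorially with the length of the word. -/
theorem eq_zero_of_factorial_growth {ι : Type*} [Fintype ι] {z : List ι → ℝ → ℂ} {c : ℝ → ι → ℝ}
    {a b C R U : ℝ} (hC : 0 ≤ C) (hR : 0 ≤ R) (hU : 0 ≤ U)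
    (hcont : ∀ w, ContinuousOn (z w) (Icc a b))
    (hder : ∀ w, ∀ t ∈ Ioo a b, HasDerivAt (z w) (∑ i, c t i • z (i :: w) t) t)
    (hc : ∀ t ∈ Ioo a b, ∑ i, ‖c t i‖ ≤ U)
    (hbd : ∀ w, ∀ t ∈ Icc a b, ‖z w t‖ ≤ C * R ^ w.length * w.length !)
    (h0 : ∀ w, z w a = 0) (hsmall : 2 * R * U * (b - a) < 1) (w : List ι) {t : ℝ}
    (ht : t ∈ Icc a b) : z w t = 0 := by
  -- Picard iteration: each integration gains `U (t - a) / n` at the price of a word one letter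
  -- longer.
  have key : ∀ (n : ℕ) (w : List ι), ∀ t ∈ Icc a b, ‖z w t‖ ≤
      C * R ^ (w.length + n) * (w.length + n)! * (U ^ n * (t - a) ^ n / n !) := by
    intro n
    induction n with
    | zero => intro w t ht; simpa using hbd w t ht
    | succ n ih =>
      intro w t ht
      set D := C * R ^ (w.length + (n + 1)) * (w.length + (n + 1))! with hD
      have hB : ∀ s : ℝ, HasDerivAt (fun s => D * (U ^ (n + 1) * (s - a) ^ (n + 1) / (n + 1)!))
          (D * (U ^ (n + 1) * (s - a) ^ n / n !)) s := fun s => by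
        have h1 := (((((hasDerivAt_id s).sub_const a).pow (n + 1)).const_mul
          (U ^ (n + 1))).div_const ((n + 1)! : ℝ)).const_mul D
        refine h1.congr_deriv ?_
        have : (n ! : ℝ) ≠ 0 := by positivity
        have : (n + 1 : ℝ) ≠ 0 := by positivity
        push_cast [Nat.factorial_succ]
        simp only [id]
        field_simp
      have := norm_le_sub_of_norm_deriv_le_Ioo (hcont w) (hder w) hB (fun s hs => ?_) (h0 w) ht
      · simpa using this
      · have hn : ∀ i, ‖c s i • z (i :: w) s‖ ≤ ‖c s i‖ * (D * (U ^ n * (s - a) ^ n / n !)) := by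
          intro i
          rw [norm_smul]
          gcongr
          have := ih (i :: w) s (Ioo_subset_Icc_self hs)
          rwa [List.length_cons, add_assoc, add_comm 1 n] at this
        refine (norm_sum_le _ _).trans ((Finset.sum_le_sum fun i _ => hn i).trans ?_)
        rw [← Finset.sum_mul]
        have hsa : 0 ≤ s - a := sub_nonneg.2 hs.1.le
        calc (∑ i, ‖c s i‖) * (D * (U ^ n * (s - a) ^ n / n !))
            ≤ U * (D * (U ^ n * (s - a) ^ n / n !)) := by
              have := hc s hs
              gcongr
          _ = D * (U ^ (n + 1) * (s - a) ^ n / n !) := by ring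
  set m := w.length
  have hta : 0 ≤ t - a := sub_nonneg.2 ht.1
  have hle : ∀ n : ℕ, ‖z w t‖ ≤ C * m ! * (2 * R) ^ m * (2 * R * U * (t - a)) ^ n := fun n => by
    refine (key n w t ht).trans ?_
    -- This turns the bound into a geometric one of ratio `2 R U (t - a) < 1`; then `n → ∞`.
    have hch : ((m + n)! : ℝ) ≤ 2 ^ (m + n) * (m ! * n !) := by
      have h1 := Nat.add_choose_mul_factorial_mul_factorial m n
      have h2 := Nat.choose_le_two_pow (m + n) n
      have : (m + n)! ≤ 2 ^ (m + n) * (m ! * n !) := by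
        rw [← h1, mul_assoc]; gcongr
      exact_mod_cast this
    have hn : (n ! : ℝ) ≠ 0 := by positivity
    calc C * R ^ (m + n) * (m + n)! * (U ^ n * (t - a) ^ n / n !)
        ≤ C * R ^ (m + n) * (2 ^ (m + n) * (m ! * n !)) * (U ^ n * (t - a) ^ n / n !) := by
          gcongr
      _ = _ := by
          simp only [mul_pow, pow_add]
          field_simp
  have hx0 : 0 ≤ 2 * R * U * (t - a) := by positivity
  have hx1 : 2 * R * U * (t - a) < 1 := by
    refine lt_of_le_of_lt ?_ hsmall
    have := ht.2
    gcongr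
  have hlim := (tendsto_pow_atTop_nhds_zero_of_lt_one hx0 hx1).const_mul (C * m ! * (2 * R) ^ m)
  rw [mul_zero] at hlim
  exact norm_le_zero_iff.1 (ge_of_tendsto' hlim hle)

end InfiniteLinearSystems

/-! ### Sufficiency of the Lie derivative condition. -/

section AnalyticSystems

variable {HS HE : Type*} [NormedAddCommGroup HS] [InnerProductSpace ℂ HS]
  [NormedAddCommGroup HE] [InnerProductSpace ℂ HE] {r : ℕ} {Q : OpenSystem HS HE r}
  {E M : Type*} [NormedAddCommGroup E] [NormedSpace ℝ E] [TopologicalSpace M] [ChartedSpace E M]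
  [IsManifold 𝓘(ℝ, E) ω M] {S : StateManifold Q E M}

namespace StateManifold.IsAnalytic

/-- The output of an analytic system, as an analytic function. -/
noncomputable def output (hS : S.IsAnalytic) :
    C^ω⟮𝓘(ℝ, ℝ).prod 𝓘(ℝ, E), ℝ × M; 𝓘(ℝ, ℂ), ℂ⟯ := ⟨S.y, hS.2.2⟩

/-- The Lie derivative along `Kᵢ`, as an operator on analytic functions. -/
noncomputable def lieK (hS : S.IsAnalytic) (i : Fin (r + 1)) :
    Module.End ℝ C^ω⟮𝓘(ℝ, ℝ).prod 𝓘(ℝ, E), ℝ × M; 𝓘(ℝ, ℂ), ℂ⟯ := lieOp (S.K i) (hS.1 i)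

/-- The Lie derivative along `K_I`, as an operator on analytic functions. -/
noncomputable def lieKI (hS : S.IsAnalytic) :
    Module.End ℝ C^ω⟮𝓘(ℝ, ℝ).prod 𝓘(ℝ, E), ℝ × M; 𝓘(ℝ, ℂ), ℂ⟯ := lieOp S.KI hS.2.1

theorem coe_foldr_lieK (hS : S.IsAnalytic) (w : List (Fin (r + 1))) :
    ⇑(w.foldr (fun i => hS.lieK i) hS.output) =
      w.foldr (fun i f => lieDeriv (S.K i) f) S.y := by
  induction w with
  | nil => rfl
  | cons i w ih => rw [List.foldr_cons, List.foldr_cons, ← ih]; rfl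

theorem lieDeriv_KI_foldr (hS : S.IsAnalytic) (w : List (Fin (r + 1))) (q : ℝ × M) :
    lieDeriv S.KI (w.foldr (fun i f => lieDeriv (S.K i) f) S.y) q =
      hS.lieKI (w.foldr (fun i => hS.lieK i) hS.output) q := by
  rw [← coe_foldr_lieK hS]; rfl

theorem decoupled (hS : S.IsAnalytic) : S.decoupled.IsAnalytic := by
  refine ⟨hS.1, ?_, hS.2.2⟩
  exact Bundle.contMDiff_zeroSection ℝ (TangentSpace (𝓘(ℝ, ℝ).prod 𝓘(ℝ, E)) : ℝ × M → Type _)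

theorem mfderiv_rhs (hS : S.IsAnalytic) (f : C^ω⟮𝓘(ℝ, ℝ).prod 𝓘(ℝ, E), ℝ × M; 𝓘(ℝ, ℂ), ℂ⟯)
    (v : Fin r → ℝ) (q : ℝ × M) :
    mfderiv (𝓘(ℝ, ℝ).prod 𝓘(ℝ, E)) 𝓘(ℝ, ℂ) f q (S.rhs v q) =
      hS.lieK 0 f q + ∑ i, v i • hS.lieK i.succ f q + hS.lieKI f q := by
  rw [StateManifold.rhs]
  refine (map_add _ _ _).trans (congrArg₂ _ ((map_add _ _ _).trans (congrArg₂ _ rfl ?_)) rfl)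
  refine (map_sum _ _ _).trans (Finset.sum_congr rfl fun i _ => ?_)
  exact map_smul _ _ _

theorem hasDerivAt_comp_solution (hS : S.IsAnalytic)
    (f : C^ω⟮𝓘(ℝ, ℝ).prod 𝓘(ℝ, E), ℝ × M; 𝓘(ℝ, ℂ), ℂ⟯) {v : Fin r → ℝ} {ξ : ℝ → M} {t : ℝ}
    (hξ : HasMFDerivAt 𝓘(ℝ, ℝ) (𝓘(ℝ, ℝ).prod 𝓘(ℝ, E)) (fun s => (s, ξ s)) t
      ((1 : ℝ →L[ℝ] ℝ).smulRight (S.rhs v (t, ξ t)))) :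
    HasDerivAt (fun s => f (s, ξ s))
      (hS.lieK 0 f (t, ξ t) + ∑ i, v i • hS.lieK i.succ f (t, ξ t) + hS.lieKI f (t, ξ t)) t :=
  hasDerivAt_comp_curve f hξ (hS.mfderiv_rhs f v (t, ξ t))

theorem decoupled_lieKI (hS : S.IsAnalytic)
    (f : C^ω⟮𝓘(ℝ, ℝ).prod 𝓘(ℝ, E), ℝ × M; 𝓘(ℝ, ℂ), ℂ⟯) (q : ℝ × M) :
    hS.decoupled.lieKI f q = 0 := map_zero (mfderiv (𝓘(ℝ, ℝ).prod 𝓘(ℝ, E)) 𝓘(ℝ, ℂ) f q)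

/-- The set of times at which all `z w` vanish, not only `z []`, is closed, contains `a`, and
extends to the right of each of its points: the values for all words are the initial data with which
the linear system restarts. -/
theorem y_eq_of_lieKI_foldr_eq_zero [CompleteSpace E] (hS : S.IsAnalytic)
    (h : ∀ (w : List (Fin (r + 1))) (q : ℝ × M),
      hS.lieKI (w.foldr (fun i => hS.lieK i) hS.output) q = 0)
    {u : ℝ → Fin r → ℝ} (hu : IsPiecewiseContinuous u) {a b : ℝ} {ξ η : ℝ → M}
    (hξ : S.IsSolution u a b ξ) (hη : S.decoupled.IsSolution u a b η) (h0 : ξ a = η a) {t : ℝ}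
    (ht : t ∈ Icc a b) : S.y (t, ξ t) = S.y (t, η t) := by
  set Y : List (Fin (r + 1)) → C^ω⟮𝓘(ℝ, ℝ).prod 𝓘(ℝ, E), ℝ × M; 𝓘(ℝ, ℂ), ℂ⟯ :=
    fun w => w.foldr (fun i => hS.lieK i) hS.output with hY
  set z : List (Fin (r + 1)) → ℝ → ℂ := fun w t => Y w (t, ξ t) - Y w (t, η t) with hz
  have hξc : ContinuousOn (fun t => (t, ξ t)) (Icc a b) := continuousOn_id.prodMk hξ.1
  have hηc : ContinuousOn (fun t => (t, η t)) (Icc a b) := continuousOn_id.prodMk hη.1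
  have hzc : ∀ w, ContinuousOn (z w) (Icc a b) := fun w =>
    ((Y w).contMDiff.continuous.comp_continuousOn hξc).sub
      ((Y w).contMDiff.continuous.comp_continuousOn hηc)
  suffices hs : Icc a b ⊆ {t | ∀ w, z w t = 0} from sub_eq_zero.1 (hs ht [])
  refine IsClosed.Icc_subset_of_forall_mem_nhdsWithin ?_ (fun w => ?_) ?_
  · have : {t | ∀ w, z w t = 0} ∩ Icc a b = ⋂ w, Icc a b ∩ z w ⁻¹' {0} := by
      ext t
      simp only [mem_inter_iff, mem_ofPred_eq, mem_iInter, mem_preimage, mem_singleton_iff]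
      exact ⟨fun h w => ⟨h.2, h.1 w⟩, fun h => ⟨fun w => (h w).2, (h []).1⟩⟩
    rw [this]
    exact isClosed_iInter fun w =>
      (hzc w).preimage_isClosed_of_isClosed isClosed_Icc isClosed_singleton
  · simp only [hz, h0, sub_self]
  rintro x ⟨hx0, hx⟩
  obtain ⟨F₁, hF₁, hξd⟩ := hξ.2
  obtain ⟨F₂, hF₂, hηd⟩ := hη.2
  have hIcc : Icc a b ∈ 𝓝[≥] x := Icc_mem_nhdsGE_of_mem hx
  -- The states `ξ x` and `η x` may differ even though all `Y w` agree on them, so bounds are needed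
  -- near both.
  obtain ⟨C₁, R₁, hC₁, hR₁, hb₁⟩ := exists_norm_foldr_lieOp_le hS.1 hS.output (x, ξ x)
  obtain ⟨C₂, R₂, hC₂, hR₂, hb₂⟩ := exists_norm_foldr_lieOp_le hS.1 hS.output (x, η x)
  have hb₁' := ((hξc x (Ico_subset_Icc_self hx)).mono_of_mem_nhdsWithin hIcc).eventually hb₁
  have hb₂' := ((hηc x (Ico_subset_Icc_self hx)).mono_of_mem_nhdsWithin hIcc).eventually hb₂
  obtain ⟨l, hl⟩ := (hu.2 x).2
  have hul : ∀ᶠ t in 𝓝[>] x, ‖u t‖ ≤ ‖l‖ + 1 :=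
    hl.norm.eventually_le_const (lt_add_one _)
  have hF : ∀ᶠ t in 𝓝[>] x, t ∉ F₁ ∪ F₂ := by
    have h1 : ((F₁ ∪ F₂) \ {x})ᶜ ∈ 𝓝 x :=
      ((hF₁.union hF₂).subset sdiff_subset).isClosed.isOpen_compl.mem_nhds (by simp)
    filter_upwards [mem_nhdsWithin_of_mem_nhds h1, self_mem_nhdsWithin] with t ht htx htF
    exact ht ⟨htF, (ne_of_gt htx : t ≠ x)⟩
  set C := C₁ + C₂
  set R := R₁ + R₂
  -- Coefficient `1` of `K₀`, plus `r` controls bounded to the right of `x` through the one-sided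
  -- limit `l`.
  set U := 1 + r * (‖l‖ + 1)
  have hU : 0 ≤ U := by positivity
  have hsmall : ∀ᶠ t in 𝓝[>] x, 2 * R * U * (t - x) < 1 := by
    have : Tendsto (fun t => 2 * R * U * (t - x)) (𝓝 x) (𝓝 (2 * R * U * (x - x))) :=
      (Continuous.tendsto (by fun_prop) x)
    rw [sub_self, mul_zero] at this
    exact (this.mono_left nhdsWithin_le_nhds).eventually_lt_const one_pos
  have hlt : ∀ᶠ t in 𝓝[>] x, t < b := mem_nhdsWithin_of_mem_nhds (Iio_mem_nhds hx.2)
  have hbd : ∀ t, (∀ w : List (Fin (r + 1)),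
      ‖Y w (t, ξ t)‖ ≤ C₁ * R₁ ^ w.length * w.length.factorial) → (∀ w : List (Fin (r + 1)),
      ‖Y w (t, η t)‖ ≤ C₂ * R₂ ^ w.length * w.length.factorial) → ∀ w,
      ‖z w t‖ ≤ C * R ^ w.length * w.length.factorial := fun t h₁ h₂ w => by
    refine (norm_sub_le _ _).trans ((add_le_add (h₁ w) (h₂ w)).trans ?_)
    rw [← add_mul]
    gcongr
    have e₁ : R₁ ≤ R := le_add_of_nonneg_right hR₂
    have e₂ : R₂ ≤ R := le_add_of_nonneg_left hR₁
    calc C₁ * R₁ ^ w.length + C₂ * R₂ ^ w.length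
        ≤ C₁ * R ^ w.length + C₂ * R ^ w.length := by gcongr
      _ = _ := by ring
  have hle : 𝓝[>] x ≤ 𝓝[≥] x := nhdsWithin_mono x Ioi_subset_Ici_self
  obtain ⟨d, hxd, hd⟩ := mem_nhdsGT_iff_exists_Ioc_subset.1
    (((hb₁'.filter_mono hle).and (hb₂'.filter_mono hle)).and ((hul.and hF).and (hsmall.and hlt)))
  have hxd' : x < d := hxd
  have hab : ∀ t ∈ Icc x d, t ∈ Icc a b := fun t ht =>
    ⟨hx.1.trans ht.1, ht.2.trans (hd ⟨hxd', le_rfl⟩).2.2.2.le⟩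
  refine mem_of_superset (Ioc_mem_nhdsGT hxd') fun t ht w => ?_
  refine eq_zero_of_factorial_growth (C := C) (R := R) (U := U) (a := x) (b := d)
    (c := fun t => Fin.cons 1 (u t)) (by positivity) (by positivity) hU
    (fun w => (hzc w).mono hab) (fun w t ht => ?_) (fun t ht => ?_) (fun w t ht => ?_) hx0
    (hd ⟨hxd', le_rfl⟩).2.2.1 w (Ioc_subset_Icc_self ht)
  · obtain ⟨-, ⟨-, htF⟩, -, htb⟩ := hd (Ioo_subset_Ioc_self ht)
    have hta : a < t := hx.1.trans_lt ht.1
    have d₁ := hS.hasDerivAt_comp_solution (Y w) (hξd t ⟨⟨hta, htb⟩, fun h => htF (Or.inl h)⟩)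
    have d₂ := hS.decoupled.hasDerivAt_comp_solution (Y w)
      (hηd t ⟨⟨hta, htb⟩, fun h => htF (Or.inr h)⟩)
    rw [h w, add_zero] at d₁
    rw [hS.decoupled_lieKI, add_zero] at d₂
    refine (d₁.sub d₂).congr_deriv ?_
    rw [Fin.sum_univ_succ]
    simp only [Fin.cons_zero, Fin.cons_succ, one_smul, hz, smul_sub, Finset.sum_sub_distrib]
    exact add_sub_add_comm _ _ _ _
  · rw [Fin.sum_univ_succ]
    simp only [Fin.cons_zero, Fin.cons_succ, norm_one]
    have h1 : ∀ i ∈ Finset.univ, ‖u t i‖ ≤ ‖l‖ + 1 := fun i _ =>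
      (norm_le_pi_norm (u t) i).trans (hd (Ioo_subset_Ioc_self ht)).2.1.1
    have h2 := Finset.sum_le_card_nsmul _ _ _ h1
    rw [Finset.card_univ, Fintype.card_fin, nsmul_eq_mul] at h2
    exact add_le_add_right h2 1
  · rcases ht.1.eq_or_lt with rfl | hxt
    · rw [hx0 w, norm_zero]
      positivity
    · obtain ⟨⟨e₁, e₂⟩, -⟩ := hd ⟨hxt, ht.2⟩
      exact hbd t e₁ e₂ w

end StateManifold.IsAnalytic

end AnalyticSystems

/-! ### From affine combinations of operators to single letters. -/

section AffineWords

variable {A : Type*} [AddCommGroup A] [Module ℝ A] {r : ℕ}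

/-- The affine family of operators `L₀ + ∑ vᵢ Lᵢ`. -/
noncomputable def affineOp (L : Fin (r + 1) → Module.End ℝ A) (v : Fin r → ℝ) : Module.End ℝ A :=
  L 0 + ∑ i, v i • L i.succ

theorem affineOp_apply (L : Fin (r + 1) → Module.End ℝ A) (v : Fin r → ℝ) (f : A) :
    affineOp L v f = L 0 f + ∑ i, v i • L i.succ f := by
  simp [affineOp]

/-- The expression is affine in `v`, so it vanishes on the affine span; evaluation at `0` and at the
basis vectors isolates each letter. -/
theorem map_eq_zero_of_affineSpan_eq_top {Ω : Set (Fin r → ℝ)} (hΩ : affineSpan ℝ Ω = ⊤)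
    (L : Fin (r + 1) → Module.End ℝ A) (D : Module.End ℝ A) (f : A)
    (h : ∀ v ∈ Ω, D (affineOp L v f) = 0) (i : Fin (r + 1)) : D (L i f) = 0 := by
  let T : (Fin r → ℝ) →ᵃ[ℝ] A :=
    (∑ i : Fin r,
      (LinearMap.proj i : (Fin r → ℝ) →ₗ[ℝ] ℝ).smulRight (D (L i.succ f))).toAffineMap +
      AffineMap.const ℝ (Fin r → ℝ) (D (L 0 f))
  have hT : ∀ v, T v = D (affineOp L v f) := fun v => by
    simp [T, affineOp_apply, add_comm]
  have hle : affineSpan ℝ Ω ≤ (⊥ : Submodule ℝ A).toAffineSubspace.comap T :=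
    affineSpan_le.2 fun v hv => by
      show T v ∈ (⊥ : Submodule ℝ A)
      rw [hT, h v hv]
      exact Submodule.zero_mem _
  have hall : ∀ v, D (affineOp L v f) = 0 := fun v => by
    have : v ∈ affineSpan ℝ Ω := hΩ ▸ AffineSubspace.mem_top ℝ _ v
    have h2 : T v ∈ (⊥ : Submodule ℝ A) := hle this
    rwa [hT] at h2
  have h0 : D (L 0 f) = 0 := by simpa [affineOp_apply] using hall 0
  refine Fin.cases h0 (fun j => ?_) i
  simpa [affineOp_apply, h0, Pi.single_apply, ite_smul] using hall (Pi.single j 1)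

theorem map_foldr_eq_zero_of_affineSpan_eq_top {Ω : Set (Fin r → ℝ)} (hΩ : affineSpan ℝ Ω = ⊤)
    (L : Fin (r + 1) → Module.End ℝ A) (B : Module.End ℝ A) (f : A)
    (h : ∀ l : List (Fin r → ℝ), (∀ v ∈ l, v ∈ Ω) → B (l.foldr (fun v => affineOp L v) f) = 0)
    (w : List (Fin (r + 1))) : B (w.foldr (fun i => L i) f) = 0 := by
  -- Letters are extracted from the innermost outwards, under an outer prefix `l` of affine
  -- operators.
  suffices H : ∀ l : List (Fin r → ℝ), (∀ v ∈ l, v ∈ Ω) →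
      B (l.foldr (fun v => affineOp L v) (w.foldr (fun i => L i) f)) = 0 from H [] (by simp)
  have hprod : ∀ (l : List (Fin r → ℝ)) (g : A),
      l.foldr (fun v => affineOp L v) g = (l.map (affineOp L)).prod g := fun l g => by
    induction l with
    | nil => rfl
    | cons v l ih => simp [ih]
  induction w with
  | nil => exact h
  | cons i w ih =>
    intro l hl
    rw [hprod]
    refine map_eq_zero_of_affineSpan_eq_top hΩ L (B * (l.map (affineOp L)).prod) _
      (fun v hv => ?_) i
    have := ih (l ++ [v]) (by simpa [or_imp, forall_and] using ⟨hl, hv⟩)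
    rw [hprod] at this
    simpa using this

end AffineWords

/-! ### Local existence and concatenation of solutions. -/

section Reachability

variable {HS HE : Type*} [NormedAddCommGroup HS] [InnerProductSpace ℂ HS]
  [NormedAddCommGroup HE] [InnerProductSpace ℂ HE] {r : ℕ} {Q : OpenSystem HS HE r}
  {E M : Type*} [NormedAddCommGroup E] [NormedSpace ℝ E] [TopologicalSpace M] [ChartedSpace E M]
  [IsManifold 𝓘(ℝ, E) ω M] {S : StateManifold Q E M}

/-- The tangent space depends on the base point, so the vector is generalized to `V q` before `q = γ
s` is substituted. -/
theorem hasMFDerivAt_smulRight_congr {F H N : Type*} [NormedAddCommGroup F] [NormedSpace ℝ F]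
    [TopologicalSpace H] {I : ModelWithCorners ℝ F H} [TopologicalSpace N] [ChartedSpace H N]
    {V : (q : N) → TangentSpace I q} {γ γ' : ℝ → N} {s : ℝ}
    (h : HasMFDerivAt 𝓘(ℝ, ℝ) I γ s ((1 : ℝ →L[ℝ] ℝ).smulRight (V (γ s))))
    (heq : γ' =ᶠ[𝓝 s] γ) :
    HasMFDerivAt 𝓘(ℝ, ℝ) I γ' s ((1 : ℝ →L[ℝ] ℝ).smulRight (V (γ' s))) := by
  have key : ∀ q, q = γ s → HasMFDerivAt 𝓘(ℝ, ℝ) I γ' s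
      ((1 : ℝ →L[ℝ] ℝ).smulRight (show TangentSpace I (γ' s) from V q)) := by
    rintro _ rfl
    exact h.congr_of_eventuallyEq heq
  exact key _ heq.self_of_nhds

namespace StateManifold

omit [IsManifold 𝓘(ℝ, E) ω M] in
theorem rhs_fst (v : Fin r → ℝ) (q : ℝ × M) : (S.rhs v q : ℝ × E).1 = 1 := by
  have h : ∀ k : Fin r → ℝ × E, (∀ i, (k i).1 = 0) → (∑ i, v i • k i).1 = 0 := fun k hk => by
    rw [Prod.fst_sum]
    exact Finset.sum_eq_zero fun i _ => by rw [Prod.smul_fst, hk, smul_zero]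
  have h' := h (fun i => S.K i.succ q) fun _ => rfl
  exact (add_zero _).trans ((congrArg (fun x : ℝ => 1 + x) h').trans (add_zero 1))

theorem IsAnalytic.contMDiff_rhs (hS : S.IsAnalytic) (v : Fin r → ℝ) :
    ContMDiff (𝓘(ℝ, ℝ).prod 𝓘(ℝ, E)) (𝓘(ℝ, ℝ).prod 𝓘(ℝ, E)).tangent ω
      (fun q : ℝ × M =>
        (⟨q, S.rhs v q⟩ : TangentBundle (𝓘(ℝ, ℝ).prod 𝓘(ℝ, E)) (ℝ × M))) := by
  refine ContMDiff.add_section (ContMDiff.add_section (hS.1 0) ?_) hS.2.1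
  exact ContMDiff.sum_section fun i _ => ContMDiff.const_smul_section (hS.1 i.succ)

/-- Local existence of solutions for constant controls. -/
theorem IsAnalytic.exists_solution [CompleteSpace E] (hS : S.IsAnalytic) (v : Fin r → ℝ) (t : ℝ)
    (p : M) : ∃ ζ : ℝ → M, ζ t = p ∧ ∀ᶠ s in 𝓝 t,
      HasMFDerivAt 𝓘(ℝ, ℝ) (𝓘(ℝ, ℝ).prod 𝓘(ℝ, E)) (fun s => (s, ζ s)) s
        ((1 : ℝ →L[ℝ] ℝ).smulRight (S.rhs v (s, ζ s))) := by
  obtain ⟨γ, hγt, hγ⟩ := exists_isMIntegralCurveAt_of_contMDiffAt_boundaryless t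
    (((hS.contMDiff_rhs v).of_le le_top : ContMDiff _ _ 1 _) (t, p))
  have hfst : ∀ᶠ s in 𝓝 t, HasDerivAt (fun s => (γ s).1) 1 s := by
    filter_upwards [hγ] with s hs
    have h1 : HasFDerivAt (fun s => (γ s).1) ((ContinuousLinearMap.fst ℝ ℝ E).comp
        ((1 : ℝ →L[ℝ] ℝ).smulRight (S.rhs v (γ s) : ℝ × E))) s :=
      ((hasMFDerivAt_fst (I := 𝓘(ℝ, ℝ)) (I' := 𝓘(ℝ, E)) (γ s)).comp s hs).hasFDerivAt
    have h2 : (ContinuousLinearMap.fst ℝ ℝ E).comp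
        ((1 : ℝ →L[ℝ] ℝ).smulRight (S.rhs v (γ s) : ℝ × E)) =
          ContinuousLinearMap.toSpanSingleton ℝ 1 := by
      refine ContinuousLinearMap.ext_ring ?_
      rw [ContinuousLinearMap.toSpanSingleton_apply_one]
      exact (one_mul _).trans (rhs_fst v (γ s))
    rw [h2] at h1
    exact h1
  -- Time runs at unit speed along the integral curve, which is therefore a graph over time.
  have htime : ∀ᶠ s in 𝓝 t, (γ s).1 = s := by
    obtain ⟨ε, hε, hball⟩ := Metric.eventually_nhds_iff_ball.1 hfst
    filter_upwards [Metric.ball_mem_nhds t hε] with s hs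
    have hd : ∀ x ∈ Metric.ball t ε, HasDerivAt (fun s => (γ s).1 - s) 0 x := fun x hx => by
      have := (hball x hx).sub (hasDerivAt_id x)
      rw [sub_self] at this
      exact this
    have := (convex_ball t ε).is_const_of_fderivWithin_eq_zero (𝕜 := ℝ)
      (f := fun s => (γ s).1 - s) (fun x hx => (hd x hx).differentiableAt.differentiableWithinAt)
      (fun x hx => ?_) hs (Metric.mem_ball_self hε)
    · simpa [hγt, sub_eq_zero] using this
    · rw [fderivWithin_of_isOpen Metric.isOpen_ball hx, (hd x hx).hasFDerivAt.fderiv]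
      simp
  refine ⟨fun s => (γ s).2, by simp [hγt], ?_⟩
  filter_upwards [htime.eventually_nhds, hγ] with s hs hγs
  have heq : (fun x => (x, (γ x).2)) =ᶠ[𝓝 s] γ := hs.mono fun x hx => Prod.ext hx.symm rfl
  exact hasMFDerivAt_smulRight_congr hγs heq

omit [IsManifold 𝓘(ℝ, E) ω M] in
/-- Prolongation of a solution by one with a constant control. -/
theorem IsSolution.extend {u : ℝ → Fin r → ℝ} {v : Fin r → ℝ} {a t b : ℝ}
    {ξ ζ : ℝ → M} (hξ : S.IsSolution u a t ξ) (hζt : ζ t = ξ t)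
    (hζ : ∀ s ∈ Icc t b, HasMFDerivAt 𝓘(ℝ, ℝ) (𝓘(ℝ, ℝ).prod 𝓘(ℝ, E)) (fun s => (s, ζ s)) s
        ((1 : ℝ →L[ℝ] ℝ).smulRight (S.rhs v (s, ζ s)))) :
    S.IsSolution (fun s => if s ≤ t then u s else v) a b (fun s => if s ≤ t then ξ s else ζ s) := by
  refine ⟨?_, ?_⟩
  · have hζc : ContinuousOn ζ (Icc t b) := fun s hs =>
      ((hζ s hs).continuousAt.snd).continuousWithinAt
    refine ContinuousOn.if (fun s hs => ?_) (hξ.1.mono ?_) (hζc.mono ?_)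
    · have : s = t := frontier_le_subset_eq (f := fun s : ℝ => s) (g := fun _ => t) continuous_id
        continuous_const hs.2
      rw [this, hζt]
    · rintro s ⟨hs, hs'⟩
      exact ⟨hs.1, (isClosed_Iic (a := t)).closure_subset hs'⟩
    · rintro s ⟨hs, hs'⟩
      refine ⟨(isClosed_Ici (a := t)).closure_subset_iff.2 (fun x hx => ?_) hs', hs.2⟩
      exact (not_le.1 hx).le
  · obtain ⟨F, hF, hd⟩ := hξ.2
    -- The two pieces match only continuously at the switching time.
    refine ⟨insert t F, hF.insert t, fun s hs => ?_⟩
    have hst : s ≠ t := fun h => hs.2 (Or.inl h)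
    rcases hst.lt_or_gt with h | h
    · have := hd s ⟨⟨hs.1.1, h⟩, fun h => hs.2 (Or.inr h)⟩
      simp only [h.le, if_true]
      refine hasMFDerivAt_smulRight_congr this ?_
      filter_upwards [Iio_mem_nhds h] with x hx
      simp [(mem_Iio.1 hx).le]
    · have := hζ s ⟨h.le, hs.1.2.le⟩
      simp only [h.not_ge, if_false]
      refine hasMFDerivAt_smulRight_congr this ?_
      filter_upwards [Ioi_mem_nhds h] with x hx
      simp [(mem_Ioi.1 hx).not_ge]

end StateManifold

theorem IsPiecewiseConstant.switch {u : ℝ → Fin r → ℝ} (hu : IsPiecewiseConstant u) (t : ℝ)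
    (v : Fin r → ℝ) : IsPiecewiseConstant (fun s => if s ≤ t then u s else v) := by
  intro a b
  obtain ⟨F, hF, h⟩ := hu a b
  refine ⟨insert t F, hF.insert t, fun s hs => ?_⟩
  have hst : s ≠ t := fun h => hs.2 (Or.inl h)
  rcases hst.lt_or_gt with hlt | hlt
  · filter_upwards [Iio_mem_nhds hlt, h s ⟨hs.1, fun h => hs.2 (Or.inr h)⟩] with x hx hx'
    simp [hlt.le, (mem_Iio.1 hx).le, hx']
  · filter_upwards [Ioi_mem_nhds hlt] with x hx
    simp [hlt.not_ge, (mem_Ioi.1 hx).not_ge]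

end Reachability

/-! ### Necessity of the Lie derivative condition. -/

section Necessity

variable {HS HE : Type*} [NormedAddCommGroup HS] [InnerProductSpace ℂ HS]
  [NormedAddCommGroup HE] [InnerProductSpace ℂ HE] {r : ℕ} {Q : OpenSystem HS HE r}
  {E M : Type*} [NormedAddCommGroup E] [NormedSpace ℝ E] [TopologicalSpace M] [ChartedSpace E M]
  {S : StateManifold Q E M} {Ω : Set (Fin r → ℝ)}

namespace StateManifold

/-- The states `p` and `p'` are reached at time `t` by solutions of the full and of the decoupled
system, respectively, that start at a common state and have a common piecewise constant control
with values in `Ω`. -/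
def JointlyReachable (S : StateManifold Q E M) (Ω : Set (Fin r → ℝ)) (t : ℝ) (p p' : M) : Prop :=
  ∃ a ≤ t, ∃ u : ℝ → Fin r → ℝ, IsPiecewiseConstant u ∧ (∀ s, u s ∈ Ω) ∧ ∃ ξ η : ℝ → M,
    S.IsSolution u a t ξ ∧ S.decoupled.IsSolution u a t η ∧ ξ a = η a ∧ ξ t = p ∧ η t = p'

/-- An interval of length zero imposes no differential equation. -/
theorem jointlyReachable_refl (hΩ : Ω.Nonempty) (t : ℝ) (p : M) : S.JointlyReachable Ω t p p := by
  obtain ⟨v, hv⟩ := hΩ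
  refine ⟨t, le_rfl, fun _ => v, fun a b => ⟨∅, finite_empty, fun _ _ => Eventually.of_forall
    fun _ => rfl⟩, fun _ => hv, fun _ => p, fun _ => p, ?_, ?_, rfl, rfl, rfl⟩ <;>
  exact ⟨continuousOn_const, ∅, finite_empty, by simp⟩

theorem JointlyReachable.extend {t b : ℝ} {p p' : M} (h : S.JointlyReachable Ω t p p') (htb : t ≤ b)
    {v : Fin r → ℝ} (hv : v ∈ Ω) {ζ ζ' : ℝ → M} (hp : ζ t = p) (hp' : ζ' t = p')
    (hζ : ∀ s ∈ Icc t b, HasMFDerivAt 𝓘(ℝ, ℝ) (𝓘(ℝ, ℝ).prod 𝓘(ℝ, E)) (fun s => (s, ζ s)) s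
        ((1 : ℝ →L[ℝ] ℝ).smulRight (S.rhs v (s, ζ s))))
    (hζ' : ∀ s ∈ Icc t b, HasMFDerivAt 𝓘(ℝ, ℝ) (𝓘(ℝ, ℝ).prod 𝓘(ℝ, E)) (fun s => (s, ζ' s)) s
        ((1 : ℝ →L[ℝ] ℝ).smulRight (S.decoupled.rhs v (s, ζ' s)))) :
    S.JointlyReachable Ω b (ζ b) (ζ' b) := by
  obtain ⟨a, hat, u, hu, huΩ, ξ, η, hξ, hη, h0, rfl, rfl⟩ := h
  refine ⟨a, hat.trans htb, _, hu.switch t v, fun s => ?_, _, _, hξ.extend hp hζ,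
    hη.extend hp' hζ', ?_, ?_, ?_⟩
  · split_ifs
    exacts [huΩ s, hv]
  · simp only [hat, if_true, h0]
  all_goals
    rcases htb.eq_or_lt with rfl | h
    · simp [hp, hp']
    · simp [h.not_ge]

variable [IsManifold 𝓘(ℝ, E) ω M] [CompleteSpace E]

omit [CompleteSpace E] in
theorem IsAnalytic.affineOp_lieK_apply (hS : S.IsAnalytic) (v : Fin r → ℝ)
    (f : C^ω⟮𝓘(ℝ, ℝ).prod 𝓘(ℝ, E), ℝ × M; 𝓘(ℝ, ℂ), ℂ⟯) (q : ℝ × M) :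
    affineOp hS.lieK v f q = hS.lieK 0 f q + ∑ i, v i • hS.lieK i.succ f q := by
  rw [affineOp_apply]
  exact congrArg (_ + ·)
    (map_sum (AddMonoidHom.mk' (fun g : C^ω⟮𝓘(ℝ, ℝ).prod 𝓘(ℝ, E), ℝ × M; 𝓘(ℝ, ℂ), ℂ⟯ => g q)
      fun _ _ => rfl) _ _)

/-- Successive differentiation of the outputs along jointly reachable states. -/
theorem IsAnalytic.foldr_eq_of_jointlyReachable (hS : S.IsAnalytic)
    (hy : ∀ t p p', S.JointlyReachable Ω t p p' → S.y (t, p) = S.y (t, p'))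
    (l : List (Fin r → ℝ)) (hl : ∀ v ∈ l, v ∈ Ω) {t : ℝ} {p p' : M}
    (h : S.JointlyReachable Ω t p p') :
    l.foldr (fun v => affineOp hS.lieK v + hS.lieKI) hS.output (t, p) =
      l.foldr (fun v => affineOp hS.lieK v) hS.output (t, p') := by
  induction l generalizing t p p' with
  | nil => exact hy t p p' h
  | cons v l ih =>
    simp only [List.mem_cons, forall_eq_or_imp] at hl
    obtain ⟨hv, hl⟩ := hl
    simp only [List.foldr_cons]
    set f := l.foldr (fun v => affineOp hS.lieK v + hS.lieKI) hS.output
    set g := l.foldr (fun v => affineOp hS.lieK v) hS.output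
    obtain ⟨ζ, hζt, hζ⟩ := hS.exists_solution v t p
    obtain ⟨ζ', hζt', hζ'⟩ := hS.decoupled.exists_solution v t p'
    have hd := hS.hasDerivAt_comp_solution f hζ.self_of_nhds
    have hd' := hS.decoupled.hasDerivAt_comp_solution g hζ'.self_of_nhds
    rw [hS.decoupled_lieKI, add_zero, hζt'] at hd'
    rw [hζt] at hd
    -- Prolongation gives agreement only at times `s ≥ t`; one-sided derivatives suffice.
    have heq : (fun s => f (s, ζ s)) =ᶠ[𝓝[≥] t] fun s => g (s, ζ' s) := by
      obtain ⟨ε, hε, hball⟩ := Metric.eventually_nhds_iff_ball.1 (hζ.and hζ')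
      filter_upwards [mem_nhdsWithin_of_mem_nhds (Metric.ball_mem_nhds t hε),
        self_mem_nhdsWithin] with s hs hts
      have hIcc : Icc t s ⊆ Metric.ball t ε := fun x hx => by
        rw [Real.ball_eq_Ioo] at hs ⊢
        exact ⟨by linarith [hx.1], hx.2.trans_lt hs.2⟩
      exact ih hl (h.extend hts hv hζt hζt' (fun x hx => (hball x (hIcc hx)).1)
        (fun x hx => (hball x (hIcc hx)).2))
    have := (uniqueDiffWithinAt_Ici t).eq_deriv _ hd.hasDerivWithinAt
      (hd'.hasDerivWithinAt.congr_of_eventuallyEq_of_mem heq self_mem_Ici)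
    exact (congrArg (· + hS.lieKI f (t, p)) (hS.affineOp_lieK_apply v f (t, p))).trans
      (this.trans (hS.affineOp_lieK_apply v g (t, p')).symm)

/-- Comparing the two words for `v :: l`, whose tails already agree, leaves exactly the term of
`L_I` applied to the affine word `l`. -/
theorem IsAnalytic.lieKI_foldr_eq_zero (hS : S.IsAnalytic) (hΩ : affineSpan ℝ Ω = ⊤)
    (hy : ∀ t p p', S.JointlyReachable Ω t p p' → S.y (t, p) = S.y (t, p'))
    (w : List (Fin (r + 1))) : hS.lieKI (w.foldr (fun i => hS.lieK i) hS.output) = 0 := by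
  have hne : Ω.Nonempty := by
    rw [nonempty_iff_ne_empty]
    rintro rfl
    rw [AffineSubspace.span_empty] at hΩ
    exact AffineSubspace.bot_ne_top ℝ _ _ hΩ
  have heq : ∀ l : List (Fin r → ℝ), (∀ v ∈ l, v ∈ Ω) →
      l.foldr (fun v => affineOp hS.lieK v + hS.lieKI) hS.output =
        l.foldr (fun v => affineOp hS.lieK v) hS.output := fun l hl => by
    ext ⟨t, p⟩
    exact hS.foldr_eq_of_jointlyReachable hy l hl (jointlyReachable_refl hne t p)
  refine map_foldr_eq_zero_of_affineSpan_eq_top hΩ hS.lieK hS.lieKI hS.output (fun l hl => ?_) w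
  obtain ⟨v, hv⟩ := hne
  have := heq (v :: l) (by simpa [hv] using hl)
  rw [List.foldr_cons, List.foldr_cons, heq l hl, LinearMap.add_apply] at this
  exact add_eq_left.1 this

end StateManifold

end Necessity

end OpenQuantum

theorem mainTheorem2 {HS HE E M : Type*}
    [NormedAddCommGroup HS] [InnerProductSpace ℂ HS] [CompleteSpace HS]
    [NormedAddCommGroup HE] [InnerProductSpace ℂ HE] [CompleteSpace HE]
    [NormedAddCommGroup E] [NormedSpace ℝ E] [CompleteSpace E]
    [TopologicalSpace M] [ChartedSpace E M] [IsManifold 𝓘(ℝ, E) ω M]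
    {r : ℕ} (Q : OpenQuantum.OpenSystem HS HE r) (S : OpenQuantum.StateManifold Q E M)
    (hS : S.IsAnalytic)
    (𝒰 : Set (ℝ → Fin r → ℝ)) (h𝒰 : OpenQuantum.IsAdmissibleClass 𝒰) :
    S.OutputInvariant 𝒰 ↔
      ∀ (w : List (Fin (r + 1))) (q : ℝ × M),
        OpenQuantum.lieDeriv S.KI
          (w.foldr (fun i f => OpenQuantum.lieDeriv (S.K i) f) S.y) q = 0 := by
  simp only [hS.lieDeriv_KI_foldr]
  refine ⟨fun h w q => ?_, fun h u hu a b _ ξ η hξ hη h0 t ht =>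
    hS.y_eq_of_lieKI_foldr_eq_zero h (h𝒰.1 u hu) hξ hη h0 ht⟩
  obtain ⟨Ω, hΩ, hΩ𝒰⟩ := h𝒰.2
  rw [hS.lieKI_foldr_eq_zero hΩ _ w]
  · rfl
  · rintro t p p' ⟨a, hat, u, hu, huΩ, ξ, η, hξ, hη, h0, rfl, rfl⟩
    exact h u (hΩ𝒰 u hu huΩ) a t hat ξ η hξ hη h0 t ⟨hat, le_rfl⟩
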